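/- Consider the two-player, two-color endgame of So Long Sucker. The players are Blue ($\mathscr B$, color $b$) and Red ($\mathscr R$, color $r$). The board consists of $k\ge 1$ piles (possibly empty stacks of $b$ and $r$ chips). A player's chips of their own color are guards, those of the other color are prisoners. The active player must place one of their chips on top of a pile. If the chip below it has the same color $y$, the player of color $y$ captures the pile: they discard exactly one chip of the pile (of their choice), take all its remaining chips, and become the active player. If there is no capture, the next active player is the player whose color does not occur in the played pile, or, if both colors occur, the player whose highest chip in that pile is the lower one. An active player without chips is eliminated, and the opponent wins, unless the opponent donates a chip to them. At any moment either player may discard one of their prisoners or donate one of their prisoners to the opponent. A winning strategy for a player is a strategy (possibly depending on the history, and possibly leaving some choices open) such that the player wins after finitely many actions, whatever the opponent does and whenever the opponent does it. For $X\in\{\mathscr B,\mathscr R\}$ with color $x$ and opponent's color $y$, let $\mathcal S$ be the following strategy for $X$, to be applied in each turn of $X$ while $X$ has an $x$ chip: (1) capture all piles with an $x$ chip on top, one after the other; (2) then discard all prisoners; (3) then place an $x$ chip on a pile of greatest length among those with a $y$ chip on top or, if there is none, on an empty pile. In every capture by $X$, a $y$ chip of the pile is discarded if there is one, and an $x$ chip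 otherwise. $X$ never donates a chip. In a turn which $X$ has to play with prisoners only, $\mathcal S$ prescribes nothing and counts as failing. Call a pile a long $x$-pile if it has at least two chips and its top chip has color $x$, and let $|\pi|_x$ be the number of $x$ chips in $\pi$. Consider a state in which any two consecutive chips in a pile have different colors (as is always the case at the beginning of a turn), the long $b$-piles are $\beta_1,\dots,\beta_h$, the long $r$-piles are $\rho_1,\dots,\rho_\ell$ ($h,\ell\ge 0$; empty sums and the empty maximum are $0$), Blue holds $m_b$ $b$ chips and $m_r$ $r$ chips, Red holds $n_b$ $b$ chips and $n_r$ $r$ chips, and Blue is the active player. Then Blue has a winning strategy if and only if $$m_b>0\quad\text{and}\quad\Big(n_r=0\ \text{ or }\ m_b+\sum_{i=1}^{h}|\beta_i|_b>n_r+\sum_{i=1}^{\ell}|\rho_i|_r-\max_{1\le i\le \ell}|\rho_i|_r\Big).$$ Red has a winning strategy if and only if Blue does not. Whenever Blue (respectively Red) has a winning strategy, $\mathcal S$ is a winning strategy for Blue (respectively Red). -/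

import Mathlib

namespace SoLongSucker

/-- The two colors left in the game. A player is identified with their designated color. -/
inductive Color
  | blue
  | red
  deriving DecidableEq

open Color

/-- The other color; equivalently, the opponent of a player. -/
def Color.other : Color → Color
  | blue => red
  | red => blue

/-- A pile is the sequence of its chips, listed from top to bottom; the empty pile is `[]`. -/
abbrev Pile := List Color

/-- The pile `π` has a chip of color `c` on top, i.e. it is a `c`-pile. -/
def TopIs (π : Pile) (c : Color) : Prop := π.head? = some c

/-- A long `c`-pile: a pile of length at least two with a `c` chip on top. -/
def LongPile (π : Pile) (c : Color) : Prop := 2 ≤ π.length ∧ TopIs π c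

/-- Any two consecutive chips of the pile have different colors. -/
def Alternating (π : Pile) : Prop := π.IsChain (· ≠ ·)

/-- What the game is waiting for. -/
inductive Phase (k : ℕ)
  /-- It is the turn of the given player, who is the active player. -/
  | turn (X : Color)
  /-- The given player has to capture the given pile. -/
  | capture (X : Color) (i : Fin k)
  /-- One player has been eliminated and the given player has won. -/
  | over (winner : Color)

/-- A position of the game with two players, two colors and `k` piles.
`hand X c` is the number of chips of color `c` in the possession of player `X`:
the guards of `X` if `c = X`, the prisoners of `X` if `c = X.other`. -/
structure Position (k : ℕ) where
  board : Fin k → Pile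
  hand : Color → Color → ℕ
  phase : Phase k

variable {k : ℕ}

/-- Add `n` chips of color `c` to the possession of player `X`. -/
def addChips (hand : Color → Color → ℕ) (X c : Color) (n : ℕ) : Color → Color → ℕ :=
  fun Y d => if Y = X ∧ d = c then hand Y d + n else hand Y d

/-- Remove one chip of color `c` from the possession of player `X`. -/
def removeChip (hand : Color → Color → ℕ) (X c : Color) : Color → Color → ℕ :=
  fun Y d => if Y = X ∧ d = c then hand Y d - 1 else hand Y d

/-- Player `X` possesses no chips. -/
def OutOfChips (p : Position k) (X : Color) : Prop := ∀ c, p.hand X c = 0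

/-- The next active player after a placement without capture, `π` being the played pile with the
new chip. If both colors occur in `π`, it is the player whose highest chip in `π` is the lower one
(piles are listed from top to bottom); otherwise it is the only player whose color is not
represented in `π`. -/
def nextPlayer (π : Pile) : Color :=
  if blue ∈ π ∧ red ∈ π then
    if π.idxOf blue < π.idxOf red then red else blue
  else if blue ∈ π then red else blue

/-- The actions of a player. Non-enforceable deals have no effect on the position. -/
inductive Move (k : ℕ)
  /-- Place a chip of color `c` on top of pile `i`. -/
  | place (c : Color) (i : Fin k)
  /-- Comply with the Capture Rule: discard one chip of color `c` from the pile to be captured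
  and take possession of all the remaining chips of that pile. -/
  | take (c : Color)
  /-- Donate one prisoner to the opponent. -/
  | donate
  /-- Discard one prisoner. -/
  | discard
  /-- Refuse to donate a chip to the active opponent who has none; the opponent is eliminated. -/
  | refuse

/-- The actions that the rules allow player `X` in position `p`. Donating and discarding prisoners
is allowed to either player at any moment before the game is over. -/
def Legal (p : Position k) (X : Color) : Move k → Prop
  | .place c _ => p.phase = .turn X ∧ 0 < p.hand X c
  | .take c => ∃ i, p.phase = .capture X i ∧ c ∈ p.board i
  | .donate => (∀ W, p.phase ≠ .over W) ∧ 0 < p.hand X X.other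
  | .discard => (∀ W, p.phase ≠ .over W) ∧ 0 < p.hand X X.other
  | .refuse => p.phase = .turn X.other ∧ OutOfChips p X.other

/-- The position after player `X` performs an action in position `p`
(only meaningful for legal actions). -/
def play (p : Position k) (X : Color) : Move k → Position k
  | .place c i =>
    { board := Function.update p.board i (c :: p.board i)
      hand := removeChip p.hand X c
      phase := if (p.board i).head? = some c then .capture c i
        else .turn (nextPlayer (c :: p.board i)) }
  | .take c =>
    match p.phase with
    | .capture _ i =>
      { board := Function.update p.board i []
        hand := removeChip
          (addChips (addChips p.hand X blue ((p.board i).count blue))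
            X red ((p.board i).count red)) X c
        phase := .turn X }
    | _ => p
  | .donate =>
    { p with hand := addChips (removeChip p.hand X X.other) X.other X.other 1 }
  | .discard => { p with hand := removeChip p.hand X X.other }
  | .refuse => { p with phase := .over X }

/-- Player `X` has to act in position `p` for the game to go on: they are active and have a chip to
place, or they have to capture a pile, or the opponent is active without chips and `X` has to
declare whether they donate a chip. -/
def MustAct (p : Position k) (X : Color) : Prop :=
  (p.phase = .turn X ∧ ¬ OutOfChips p X) ∨
  (∃ i, p.phase = .capture X i) ∨
  (p.phase = .turn X.other ∧ OutOfChips p X.other)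

/-- A strategy of a player: for every history of the game (the actions performed so far, latest
first, each with the player who performed it) and current position, the set of actions that the
strategy prescribes. Several elements mean that the strategy leaves a choice open; the empty set
means that the player waits for the opponent to act. -/
abbrev Strategy (k : ℕ) := List (Color × Move k) → Position k → Set (Move k)

/-- `WinsFrom σ X hist p`: after the history `hist`, in the position `p`, player `X` wins within
finitely many actions whenever `X` acts according to `σ`, whichever prescribed actions `X` chooses,
whatever legal actions the opponent performs, and in whatever order the actions of the two players
interleave. Every prescribed action has to be legal, and `X` must not wait when `X` must act. -/
inductive WinsFrom (σ : Strategy k) (X : Color) : List (Color × Move k) → Position k → Prop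
  | won {hist : List (Color × Move k)} {p : Position k} (h : p.phase = .over X) :
      WinsFrom σ X hist p
  | step {hist : List (Color × Move k)} {p : Position k}
      (notOver : ∀ W, p.phase ≠ .over W)
      (acts : MustAct p X → (σ hist p).Nonempty)
      (legal : ∀ m ∈ σ hist p, Legal p X m)
      (own : ∀ m ∈ σ hist p, WinsFrom σ X ((X, m) :: hist) (play p X m))
      (opponent : ∀ m, Legal p X.other m →
        WinsFrom σ X ((X.other, m) :: hist) (play p X.other m)) :
      WinsFrom σ X hist p

/-- `σ` is a winning strategy for player `X` in the game that starts in position `p`. -/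
def IsWinningStrategy (σ : Strategy k) (X : Color) (p : Position k) : Prop :=
  WinsFrom σ X [] p

/-- Player `X` has a winning strategy in the game that starts in position `p`. -/
def HasWinningStrategy (X : Color) (p : Position k) : Prop :=
  ∃ σ : Strategy k, IsWinningStrategy σ X p

/-- The strategy `𝒮` for player `X`. In their turn, with at least one guard:
as long as there is an `X`-pile, capture one; then discard all prisoners; then place a guard on an
opponent's pile of greatest length, or on an empty pile if there is no such pile.
When capturing, discard a prisoner from the pile if it contains one, and a guard otherwise.
Never donate a chip. In their turn without any guard, `𝒮` prescribes nothing. -/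
inductive StrategyS (X : Color) (p : Position k) : Move k → Prop
  | capturePile (i : Fin k) (hturn : p.phase = .turn X) (hguard : 0 < p.hand X X)
      (htop : TopIs (p.board i) X) : StrategyS X p (.place X i)
  | discardPrisoner (hturn : p.phase = .turn X) (hguard : 0 < p.hand X X)
      (hnone : ∀ j, ¬ TopIs (p.board j) X) (hprisoner : 0 < p.hand X X.other) :
      StrategyS X p .discard
  | placeOnLongest (i : Fin k) (hturn : p.phase = .turn X) (hguard : 0 < p.hand X X)
      (hnone : ∀ j, ¬ TopIs (p.board j) X) (hprisoner : p.hand X X.other = 0)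
      (htop : TopIs (p.board i) X.other)
      (hmax : ∀ j, TopIs (p.board j) X.other → (p.board j).length ≤ (p.board i).length) :
      StrategyS X p (.place X i)
  | placeOnEmpty (i : Fin k) (hturn : p.phase = .turn X) (hguard : 0 < p.hand X X)
      (hnone : ∀ j, ¬ TopIs (p.board j) X) (hprisoner : p.hand X X.other = 0)
      (hnone' : ∀ j, ¬ TopIs (p.board j) X.other) (hempty : p.board i = []) :
      StrategyS X p (.place X i)
  | takeDiscardingPrisoner (i : Fin k) (hcap : p.phase = .capture X i)
      (hmem : X.other ∈ p.board i) : StrategyS X p (.take X.other)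
  | takeDiscardingGuard (i : Fin k) (hcap : p.phase = .capture X i)
      (hmem : X.other ∉ p.board i) : StrategyS X p (.take X)
  | refuseDonation (hturn : p.phase = .turn X.other) (hout : OutOfChips p X.other) :
      StrategyS X p .refuse

/-- `𝒮` as a strategy; it depends only on the current position. -/
def strategyS (k : ℕ) (X : Color) : Strategy k := fun _ p => {m | StrategyS X p m}

/-- The position with the given board in which Blue holds `mb` blue and `mr` red chips,
Red holds `nb` blue and `nr` red chips, and Blue is the active player. -/
def startPosition (board : Fin k → Pile) (mb mr nb nr : ℕ) : Position k where
  board := board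
  hand
    | blue, blue => mb
    | blue, red => mr
    | red, blue => nb
    | red, red => nr
  phase := .turn blue

open Classical in
/-- The sum, over all long `c`-piles of the board, of the number of `c` chips in the pile. -/
noncomputable def longSum (board : Fin k → Pile) (c : Color) : ℕ :=
  ∑ i with LongPile (board i) c, (board i).count c

open Classical in
/-- The maximum, over all long `c`-piles of the board, of the number of `c` chips in the pile;
it is `0` if there is no long `c`-pile. -/
noncomputable def longMax (board : Fin k → Pile) (c : Color) : ℕ :=
  (Finset.univ.filter fun i => LongPile (board i) c).sup fun i => (board i).count c

end SoLongSucker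

/-!
Every action that does not end the game makes the pair (number of chips in the game, weight of the
chips in hand) drop lexicographically (`rank_play_lt`), so every play is finite, and until the game
is over somebody has to act. Hence the two players cannot both have winning strategies (`not_wins_both`), and it is enough
to show that `𝒮` wins for Blue under the stated condition and for Red under its negation.

For both, fix the player `X` who uses `𝒮`, with opponent `Y`. Let `a` and `c` be the numbers of
guards of `X` and `Y`, let `Σ_X` and `Σ_Y` be the sums `longSum` for the two colors, and `M_X` and
`M_Y` the maxima `longMax`. Consider the conditions

* `Ahead`: `0 < a` and (`c = 0` or `c + Σ_Y - M_Y < a + Σ_X`), when `X` is active;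
* `Holds`: `c = 0` or (`0 < a` and `c + Σ_Y ≤ a + Σ_X - M_X`), when `Y` is active,

the second being the negation of the first with the players exchanged. They form an invariant
(`Invariant`), a position in which a pile is about to be captured being judged by the position after
the best possible capture. The point is that capturing an alternating `x`-pile, with an `x` chip
placed on it, changes the guards plus `longSum` of the captor by nothing if the chip was a guard of
the captor, and by one if it was a prisoner of the opponent (`reward_cons`). A guard placed on a
pile of the opponent takes at most their maximum away, and exactly that if the pile is longest
(`weight_le_of_length_le`). After a placement without capture, the player whose color was placed is
not the next active player (`nextPlayer_cons`), so an opponent who has only prisoners either stays active until they run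
out of chips, or lets `X` capture. Since `X` has a guard whenever `X` is active, `X` is never
eliminated, and as the play ends, `X` wins.
-/

namespace SoLongSucker

open Color

variable {k : ℕ}

/-! ### Colors, piles and hands -/

@[simp] theorem Color.other_other (c : Color) : c.other.other = c := by cases c <;> rfl

@[simp] theorem Color.other_ne (c : Color) : c.other ≠ c := by cases c <;> simp [Color.other]

@[simp] theorem Color.ne_other (c : Color) : c ≠ c.other := by cases c <;> simp [Color.other]

theorem Color.eq_other_of_ne {c d : Color} (h : d ≠ c) : d = c.other := by
  cases c <;> cases d <;> simp_all [Color.other]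

@[simp] theorem removeChip_self (hand : Color → Color → ℕ) (X c : Color) :
    removeChip hand X c X c = hand X c - 1 := by simp [removeChip]

theorem removeChip_of_ne (hand : Color → Color → ℕ) {X c Y d : Color} (h : Y ≠ X ∨ d ≠ c) :
    removeChip hand X c Y d = hand Y d := by
  unfold removeChip
  rw [if_neg (by tauto)]

theorem addChips_self (hand : Color → Color → ℕ) (X c : Color) (n : ℕ) :
    addChips hand X c n X c = hand X c + n := by simp [addChips]

/-- The number of `d` chips of a player who has captured `π` and discarded a `c` chip of it. -/
theorem hand_take_self (hand : Color → Color → ℕ) (X c d : Color) (π : Pile) :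
    removeChip (addChips (addChips hand X blue (π.count blue)) X red (π.count red)) X c X d
      = hand X d + π.count d - if d = c then 1 else 0 := by
  cases c <;> cases d <;> simp [removeChip, addChips]

theorem hand_take_other (hand : Color → Color → ℕ) {X Y : Color} (h : Y ≠ X) (c d : Color)
    (m n : ℕ) :
    removeChip (addChips (addChips hand X blue m) X red n) X c Y d = hand Y d := by
  simp [removeChip, addChips, h]

theorem nextPlayer_cons {c : Color} {π : Pile} (h : ¬ TopIs π c) :
    nextPlayer (c :: π) = c.other := by
  cases π with
  | nil => cases c <;> simp [nextPlayer, Color.other]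
  | cons d l =>
    have hd : d = c.other := Color.eq_other_of_ne (by simpa [TopIs] using h)
    subst hd
    cases c <;> simp [nextPlayer, Color.other]

theorem Alternating.cons {c : Color} {π : Pile} (hπ : Alternating π) (h : ¬ TopIs π c) :
    Alternating (c :: π) := by
  cases π with
  | nil => simp [Alternating]
  | cons d l =>
    refine List.isChain_cons_cons.2 ⟨?_, hπ⟩
    rintro rfl
    exact h rfl

theorem alternating_nil : Alternating [] := by simp [Alternating]

theorem TopIs.not_other {c : Color} {π : Pile} (h : TopIs π c) : ¬ TopIs π c.other := by
  unfold TopIs at *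
  simp [h]

theorem eq_nil_of_not_topIs {c : Color} {π : Pile} (h : ¬ TopIs π c) (h' : ¬ TopIs π c.other) :
    π = [] := by
  cases π with
  | nil => rfl
  | cons d l =>
    by_cases hd : d = c
    · exact absurd (by simp [TopIs, hd]) h
    · exact absurd (by simp [TopIs, Color.eq_other_of_ne hd]) h'

/-- The chips of an alternating pile are half of each color, rounded in favor of the top. -/
theorem count_of_alternating (l : List Color) (c : Color) (h : Alternating (c :: l)) :
    (c :: l).count c = (l.length + 2) / 2 ∧ (c :: l).count c.other = (l.length + 1) / 2 := by
  induction l generalizing c with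
  | nil => simp
  | cons d l ih =>
    obtain ⟨hcd, hl⟩ := List.isChain_cons_cons.1 h
    obtain rfl : d = c.other := Color.eq_other_of_ne (Ne.symm hcd)
    have := ih _ hl
    rw [Color.other_other] at this
    rw [List.count_cons_self, List.count_cons_of_ne (Color.ne_other c), this.1, this.2,
      List.length_cons]
    omega

/-! ### Contributions of single piles -/

open Classical in
/-- The contribution of a pile to `longSum` for the color `c`. -/
noncomputable def weight (c : Color) (π : Pile) : ℕ := if LongPile π c then π.count c else 0

/-- The largest number of `c` chips that the player of color `c` can gain by capturing `π`: all of
them if another chip can be discarded, and all but one otherwise. -/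
def reward (c : Color) (π : Pile) : ℕ := π.count c - if c.other ∈ π then 0 else 1

theorem weight_of_not_topIs {c : Color} {π : Pile} (h : ¬ TopIs π c) : weight c π = 0 :=
  if_neg fun hl => h hl.2

theorem weight_nil (c : Color) : weight c [] = 0 := weight_of_not_topIs (by simp [TopIs])

theorem reward_cons {c : Color} {π : Pile} (hπ : Alternating π) (h : TopIs π c) :
    reward c (c :: π) = weight c π + 1 := by
  obtain ⟨l, rfl⟩ : ∃ l, π = c :: l := by
    cases π with
    | nil => simp [TopIs] at h
    | cons d l => exact ⟨l, by simp_all [TopIs]⟩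
  cases l with
  | nil => simp [reward, weight, LongPile]
  | cons d l =>
    obtain rfl : d = c.other := Color.eq_other_of_ne (Ne.symm (List.isChain_cons_cons.1 hπ).1)
    simp [reward, weight, LongPile, TopIs]

theorem weight_le_of_length_le {c : Color} {π σ : Pile} (hπ : Alternating π) (hσ : Alternating σ)
    (h : TopIs π c) (hle : TopIs σ c → σ.length ≤ π.length) : weight c σ ≤ weight c π := by
  by_cases hl : LongPile σ c
  · have hlen := hle hl.2
    have hl' : LongPile π c := ⟨hl.1.trans hlen, h⟩
    simp only [weight, hl, hl', if_true]
    obtain ⟨u, rfl⟩ : ∃ u, π = c :: u := ⟨π.tail, List.eq_cons_of_mem_head? h⟩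
    obtain ⟨v, rfl⟩ : ∃ v, σ = c :: v := ⟨σ.tail, List.eq_cons_of_mem_head? hl.2⟩
    rw [(count_of_alternating u c hπ).1, (count_of_alternating v c hσ).1]
    simp only [List.length_cons] at hlen
    omega
  · simp [weight, hl]

theorem sum_update_add (f : Pile → ℕ) (B : Fin k → Pile) (i : Fin k) (π : Pile) :
    ∑ j, f (Function.update B i π j) + f (B i) = ∑ j, f (B j) + f π := by
  have h := Finset.add_sum_erase Finset.univ (fun j => f (B j)) (Finset.mem_univ i)
  have h' := Finset.add_sum_erase Finset.univ (fun j => f (Function.update B i π j))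
    (Finset.mem_univ i)
  have e : ∑ j ∈ Finset.univ.erase i, f (Function.update B i π j)
      = ∑ j ∈ Finset.univ.erase i, f (B j) :=
    Finset.sum_congr rfl fun j hj => by rw [Function.update_of_ne (Finset.ne_of_mem_erase hj)]
  simp only [Function.update_self] at h'
  omega

theorem longSum_eq (B : Fin k → Pile) (c : Color) : longSum B c = ∑ i, weight c (B i) := by
  simp only [longSum, weight, Finset.sum_filter]

theorem longSum_update (B : Fin k → Pile) (i : Fin k) (π : Pile) (c : Color) :
    longSum (Function.update B i π) c + weight c (B i) = longSum B c + weight c π := by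
  simpa only [longSum_eq] using sum_update_add (weight c) B i π

theorem longMax_le {B : Fin k → Pile} {c : Color} {n : ℕ} :
    longMax B c ≤ n ↔ ∀ i, weight c (B i) ≤ n := by
  simp only [longMax, weight, Finset.sup_le_iff, Finset.mem_filter, Finset.mem_univ, true_and]
  refine forall_congr' fun i => ?_
  split_ifs with h <;> simp [h]

theorem weight_le_longMax (B : Fin k → Pile) (c : Color) (i : Fin k) :
    weight c (B i) ≤ longMax B c := longMax_le.1 le_rfl i

theorem longMax_le_longSum (B : Fin k → Pile) (c : Color) : longMax B c ≤ longSum B c := by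
  rw [longMax_le, longSum_eq]
  exact fun i => Finset.single_le_sum (f := fun j => weight c (B j)) (fun _ _ => Nat.zero_le _)
    (Finset.mem_univ i)

theorem longMax_update_le (B : Fin k → Pile) (i : Fin k) (π : Pile) (c : Color) :
    longMax (Function.update B i π) c ≤ longMax B c + weight c π := by
  rw [longMax_le]
  intro j
  by_cases h : j = i
  · subst h
    simp
  · rw [Function.update_of_ne h]
    exact (weight_le_longMax B c j).trans (Nat.le_add_right _ _)

theorem weight_le_longMax_update (B : Fin k → Pile) (i : Fin k) (π : Pile) (c : Color) :
    weight c π ≤ longMax (Function.update B i π) c := by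
  simpa using weight_le_longMax (Function.update B i π) c i

theorem longMax_update_of_weight_eq {B : Fin k → Pile} {i : Fin k} {π : Pile} {c : Color}
    (h : weight c π = weight c (B i)) : longMax (Function.update B i π) c = longMax B c := by
  apply le_antisymm <;> rw [longMax_le] <;> intro j <;> by_cases hj : j = i
  · subst hj
    simpa [h] using weight_le_longMax B c j
  · simpa [hj] using weight_le_longMax B c j
  · subst hj
    rw [← h]
    exact weight_le_longMax_update B j π c
  · simpa [hj] using weight_le_longMax (Function.update B i π) c j

theorem alternating_update {B : Fin k → Pile} (hB : ∀ j, Alternating (B j)) (i : Fin k) {π : Pile}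
    (hπ : Alternating π) (j : Fin k) : Alternating (Function.update B i π j) := by
  by_cases hj : j = i
  · subst hj
    simpa using hπ
  · simpa [hj] using hB j

/-! ### The invariant -/

/-- The condition under which `X`, being active, wins on the board `B` if `X` has `a` guards and the
opponent has `c` guards. -/
def Ahead (X : Color) (B : Fin k → Pile) (a c : ℕ) : Prop :=
  0 < a ∧ (c = 0 ∨ c + longSum B X.other < a + longSum B X + longMax B X.other)

/-- The condition under which `X` wins on the board `B` if the opponent is active, `X` has `a`
guards and the opponent has `c` guards. -/
def Holds (X : Color) (B : Fin k → Pile) (a c : ℕ) : Prop :=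
  c = 0 ∨ 0 < a ∧ c + longSum B X.other + longMax B X ≤ a + longSum B X

theorem Ahead.mono {X : Color} {B : Fin k → Pile} {a a' c : ℕ} (h : Ahead X B a c) (ha : a ≤ a') :
    Ahead X B a' c := by
  unfold Ahead at *
  omega

theorem Holds.mono {X : Color} {B : Fin k → Pile} {a a' c c' : ℕ} (h : Holds X B a c)
    (ha : a ≤ a') (hc : c' ≤ c) : Holds X B a' c' := by
  unfold Holds at *
  omega

/-- The positions from which `𝒮` wins for `X`. While a pile is being captured, only the other
piles need be alternating, and the guards of the captor include the reward for the capture. -/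
inductive Invariant (X : Color) (p : Position k) : Prop
  | finished (hphase : p.phase = .over X)
  | active (hphase : p.phase = .turn X) (halt : ∀ i, Alternating (p.board i))
      (h : Ahead X p.board (p.hand X X) (p.hand X.other X.other))
  | waiting (hphase : p.phase = .turn X.other) (halt : ∀ i, Alternating (p.board i))
      (h : Holds X p.board (p.hand X X) (p.hand X.other X.other))
  | capturing (i : Fin k) (hphase : p.phase = .capture X i)
      (halt : ∀ j, Alternating (Function.update p.board i [] j)) (hmem : X ∈ p.board i)
      (h : Ahead X (Function.update p.board i []) (p.hand X X + reward X (p.board i))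
        (p.hand X.other X.other))
  | captured (i : Fin k) (hphase : p.phase = .capture X.other i)
      (halt : ∀ j, Alternating (Function.update p.board i [] j))
      (h : Holds X (Function.update p.board i []) (p.hand X X)
        (p.hand X.other X.other + reward X.other (p.board i)))

/-- Changing hands without touching the board or the phase is harmless if `X` loses no guards and
the opponent gains none. -/
theorem Invariant.change_hand {X : Color} {p : Position k} (hp : Invariant X p)
    {hand : Color → Color → ℕ} (ha : p.hand X X ≤ hand X X)
    (hc : hand X.other X.other = p.hand X.other X.other) :
    Invariant X { p with hand := hand } := by
  cases hp with
  | finished h => exact .finished h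
  | active h1 h2 h3 => exact .active h1 h2 (by simpa only [hc] using h3.mono ha)
  | waiting h1 h2 h3 => exact .waiting h1 h2 (h3.mono ha hc.le)
  | capturing i h1 h2 h3 h4 =>
    exact .capturing i h1 h2 h3 (by simpa only [hc] using h4.mono (Nat.add_le_add_right ha _))
  | captured i h1 h2 h3 => exact .captured i h1 h2 (h3.mono ha (by simp only [hc]; exact le_rfl))

/-! ### Preservation by placements -/

/-- The numeric effect of emptying a pile with a `c` chip on top: the `c` chips of the pile leave
`longSum` for `c`, and nothing changes for the other color. -/
theorem longSum_update_nil {B : Fin k → Pile} {i : Fin k} {c : Color} (htop : TopIs (B i) c) :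
    longSum (Function.update B i []) c + weight c (B i) = longSum B c ∧
    longSum (Function.update B i []) c.other = longSum B c.other ∧
    longMax (Function.update B i []) c.other = longMax B c.other := by
  have h1 := longSum_update B i [] c
  have h2 := longSum_update B i [] c.other
  have h3 := weight_of_not_topIs htop.not_other
  have h4 := weight_nil c
  have h5 := weight_nil c.other
  exact ⟨by omega, by omega, longMax_update_of_weight_eq (h5.trans h3.symm)⟩

/-- A placement that leads to a capture: `X` places a guard on an `X`-pile, or the opponent places
a chip on a pile of that color. If that chip is a prisoner, it is `X` who captures. -/
theorem Invariant.place_of_topIs {X : Color} {p : Position k} {i : Fin k} {Z c : Color}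
    (halt : ∀ i, Alternating (p.board i)) (htop : TopIs (p.board i) c) (hZ : 0 < p.hand Z c)
    (hp : (Z = X ∧ c = X ∧ Ahead X p.board (p.hand X X) (p.hand X.other X.other)) ∨
      (Z = X.other ∧ Holds X p.board (p.hand X X) (p.hand X.other X.other))) :
    Invariant X (play p Z (.place c i)) := by
  obtain ⟨h1, h2, h3⟩ := longSum_update_nil htop
  have hr := reward_cons (halt i) htop
  have hcap : (play p Z (.place c i)).phase = .capture c i := if_pos htop
  have hboard : (play p Z (.place c i)).board i = c :: p.board i := by simp [play]
  have hupd : Function.update (play p Z (.place c i)).board i [] = Function.update p.board i [] := by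
    simp [play]
  have halt' := alternating_update halt i alternating_nil
  have hhand : (play p Z (.place c i)).hand = removeChip p.hand Z c := rfl
  by_cases hc : c = X
  · subst hc
    refine .capturing i hcap (by rwa [hupd]) (by simp [hboard]) ?_
    rw [hupd, hhand, hboard, hr]
    have hM := longMax_le_longSum p.board c.other
    rcases hp with ⟨rfl, -, hA⟩ | ⟨rfl, hH⟩
    · rw [removeChip_self, removeChip_of_ne _ (by simp)]
      unfold Ahead at *
      omega
    · rw [removeChip_of_ne _ (by simp), removeChip_of_ne _ (by simp)]
      unfold Ahead Holds at *
      omega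
  · obtain rfl := Color.eq_other_of_ne hc
    rw [Color.other_other] at h2 h3
    rcases hp with ⟨-, hc', -⟩ | ⟨rfl, hH⟩
    · exact absurd hc' hc
    · refine .captured i hcap (by rwa [hupd]) ?_
      rw [hupd, hhand, hboard, hr, removeChip_self, removeChip_of_ne _ (by simp)]
      unfold Holds at *
      omega

/-- A placement of the opponent that leads to no capture. -/
theorem Invariant.place_opponent {X : Color} {p : Position k} {i : Fin k} {c : Color}
    (halt : ∀ i, Alternating (p.board i)) (htop : ¬ TopIs (p.board i) c)
    (hc : 0 < p.hand X.other c)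
    (hp : Holds X p.board (p.hand X X) (p.hand X.other X.other)) :
    Invariant X (play p X.other (.place c i)) := by
  have hphase : (play p X.other (.place c i)).phase = .turn c.other :=
    (if_neg htop).trans (by rw [nextPlayer_cons htop])
  have halt' := alternating_update halt i ((halt i).cons htop)
  have hS := longSum_update p.board i (c :: p.board i)
  have hw : weight c (p.board i) = 0 := weight_of_not_topIs htop
  have hw' : weight c.other (c :: p.board i) = 0 := weight_of_not_topIs (by simp [TopIs])
  have hM := longMax_update_le p.board i (c :: p.board i)
  have hM' := weight_le_longMax_update p.board i (c :: p.board i)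
  have hM'' := fun d => weight_le_longMax p.board d i
  by_cases hcX : c = X
  -- A prisoner gives the pile to `X` for free, and the opponent stays active.
  · subst hcX
    refine .waiting hphase halt' ?_
    have h1 := hS c
    have h2 := hS c.other
    have h3 := hM c
    change Holds c _ (removeChip _ _ _ _ _) (removeChip _ _ _ _ _)
    rw [removeChip_of_ne _ (by simp), removeChip_of_ne _ (by simp)]
    simp only [play]
    unfold Holds at *
    omega
  -- A guard costs `X` at most the largest of their long piles.
  · obtain rfl := Color.eq_other_of_ne hcX
    rw [Color.other_other] at hphase hw'
    refine .active hphase halt' ?_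
    have h1 := hS X
    have h2 := hS X.other
    have h3 := hM' X.other
    have h4 := hM'' X
    change Ahead X _ (removeChip _ _ _ _ _) (removeChip _ _ _ _ _)
    rw [removeChip_of_ne _ (by simp), removeChip_self]
    simp only [play]
    unfold Ahead Holds at *
    omega

/-- With no `X`-pile left, `X` places a guard on a pile whose contribution to the opponent is
largest. -/
theorem Invariant.place_own {X : Color} {p : Position k} {i : Fin k}
    (halt : ∀ i, Alternating (p.board i)) (hnone : ∀ j, ¬ TopIs (p.board j) X)
    (hmax : ∀ j, weight X.other (p.board j) ≤ weight X.other (p.board i))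
    (hp : Ahead X p.board (p.hand X X) (p.hand X.other X.other)) :
    Invariant X (play p X (.place X i)) := by
  have hphase : (play p X (.place X i)).phase = .turn X.other :=
    (if_neg (hnone i)).trans (by rw [nextPlayer_cons (hnone i)])
  refine .waiting hphase (alternating_update halt i ((halt i).cons (hnone i))) ?_
  have hw : weight X.other (X :: p.board i) = 0 := weight_of_not_topIs (by simp [TopIs])
  have h0 : ∀ j, weight X (p.board j) = 0 := fun j => weight_of_not_topIs (hnone j)
  have hS0 : longSum p.board X = 0 := by simp [longSum_eq, h0]
  have hM0 : longMax p.board X ≤ 0 := longMax_le.2 fun j => (h0 j).le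
  have h1 := longSum_update p.board i (X :: p.board i) X
  have h2 := longSum_update p.board i (X :: p.board i) X.other
  have h3 := longMax_update_le p.board i (X :: p.board i) X
  have h4 := longMax_le.2 hmax
  change Holds X _ (removeChip _ _ _ _ _) (removeChip _ _ _ _ _)
  rw [removeChip_self, removeChip_of_ne _ (by simp)]
  simp only [play]
  have := h0 i
  unfold Ahead Holds at *
  omega

/-! ### Preservation by all actions -/

theorem play_take {p : Position k} {Z : Color} {i : Fin k} (h : p.phase = .capture Z i)
    (W c : Color) :
    play p W (.take c) =
      { board := Function.update p.board i []
        hand := removeChip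
          (addChips (addChips p.hand W blue ((p.board i).count blue))
            W red ((p.board i).count red)) W c
        phase := .turn W } := by
  simp only [play, h]

theorem Invariant.own {X : Color} {p : Position k} (hp : Invariant X p) {m : Move k}
    (hm : StrategyS X p m) : Legal p X m ∧ Invariant X (play p X m) := by
  have hturn : p.phase = .turn X → (∀ i, Alternating (p.board i)) ∧
      Ahead X p.board (p.hand X X) (p.hand X.other X.other) := by
    intro h
    cases hp <;> simp_all
  cases hm with
  | capturePile i ht hg htop =>
    obtain ⟨halt, hA⟩ := hturn ht
    exact ⟨⟨ht, hg⟩, .place_of_topIs halt htop hg (.inl ⟨rfl, rfl, hA⟩)⟩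
  | discardPrisoner ht hg hnone hpr =>
    exact ⟨⟨by simp [ht], hpr⟩, hp.change_hand (by rw [removeChip_of_ne _ (by simp)])
      (by rw [removeChip_of_ne _ (by simp)])⟩
  | placeOnLongest i ht hg hnone hpr htop hmax =>
    obtain ⟨halt, hA⟩ := hturn ht
    exact ⟨⟨ht, hg⟩, .place_own halt hnone
      (fun j => weight_le_of_length_le (halt i) (halt j) htop (hmax j)) hA⟩
  | placeOnEmpty i ht hg hnone hpr hnone' hempty =>
    obtain ⟨halt, hA⟩ := hturn ht
    exact ⟨⟨ht, hg⟩, .place_own halt hnone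
      (fun j => by rw [weight_of_not_topIs (hnone' j)]; exact Nat.zero_le _) hA⟩
  | takeDiscardingPrisoner i hcap hmem =>
    refine ⟨⟨i, hcap, hmem⟩, ?_⟩
    cases hp with
    | capturing j hphase halt hX h =>
      obtain rfl : j = i := by simp_all
      rw [play_take hcap]
      refine .active rfl halt ?_
      simp only [hand_take_self, hand_take_other _ (Color.other_ne X), Color.ne_other, if_false]
      simpa [reward, hmem] using h
    | _ => simp_all
  | takeDiscardingGuard i hcap hmem =>
    cases hp with
    | capturing j hphase halt hX h =>
      obtain rfl : j = i := by simp_all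
      refine ⟨⟨j, hcap, hX⟩, ?_⟩
      rw [play_take hcap]
      refine .active rfl halt ?_
      simp only [hand_take_self, hand_take_other _ (Color.other_ne X), if_true]
      have := List.count_pos_iff.2 hX
      simp only [reward, hmem, if_false] at h
      exact h.mono (by omega)
    | _ => simp_all
  | refuseDonation ht hout => exact ⟨⟨ht, hout⟩, .finished rfl⟩

theorem Invariant.opponent {X : Color} {p : Position k} (hp : Invariant X p) {m : Move k}
    (hm : Legal p X.other m) : Invariant X (play p X.other m) := by
  cases m with
  | place c i =>
    obtain ⟨ht, hc⟩ := hm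
    cases hp with
    | waiting hphase halt h =>
      by_cases htop : TopIs (p.board i) c
      · exact .place_of_topIs halt htop hc (.inr ⟨rfl, h⟩)
      · exact .place_opponent halt htop hc h
    | _ => simp_all
  | take c =>
    obtain ⟨i, hcap, hmem⟩ := hm
    cases hp with
    | captured j hphase halt h =>
      obtain rfl : j = i := by simp_all
      rw [play_take hcap]
      refine .waiting rfl halt ?_
      simp only [hand_take_self, hand_take_other _ (Color.ne_other X)]
      refine h.mono le_rfl ?_
      unfold reward
      have h1 := List.count_pos_iff.2 hmem
      by_cases hc : X.other = c
      · subst hc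
        rw [if_pos rfl]
        split_ifs <;> omega
      · have hcX : X = c := by simpa using (Color.eq_other_of_ne (Ne.symm hc)).symm
        simp [hcX, hmem]
    | _ => simp_all
  | donate =>
    refine hp.change_hand ?_ ?_
    · rw [Color.other_other, addChips_self, removeChip_of_ne _ (by simp)]
      exact Nat.le_add_right _ _
    · simp [addChips, removeChip]
  | discard =>
    exact hp.change_hand (by rw [removeChip_of_ne _ (by simp)])
      (by rw [removeChip_of_ne _ (by simp)])
  | refuse =>
    -- The opponent cannot eliminate `X`, who has a guard whenever active.
    obtain ⟨ht, hout⟩ := hm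
    rw [Color.other_other] at ht hout
    cases hp with
    | active hphase halt h => exact absurd (hout X) h.1.ne'
    | _ => simp_all

theorem Invariant.acts (hk : 0 < k) {X : Color} {p : Position k} (hp : Invariant X p)
    (hact : MustAct p X) : ∃ m, StrategyS X p m := by
  rcases hact with ⟨ht, -⟩ | ⟨i, hcap⟩ | ⟨ht, hout⟩
  · have hg : 0 < p.hand X X := by
      cases hp with
      | active hphase halt h => exact h.1
      | _ => simp_all
    by_cases hX : ∃ i, TopIs (p.board i) X
    · obtain ⟨i, hi⟩ := hX
      exact ⟨_, .capturePile i ht hg hi⟩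
    push Not at hX
    by_cases hpr : 0 < p.hand X X.other
    · exact ⟨_, .discardPrisoner ht hg hX hpr⟩
    have hpr' : p.hand X X.other = 0 := by omega
    by_cases hY : ∃ i, TopIs (p.board i) X.other
    · have hne : ({i | TopIs (p.board i) X.other} : Set (Fin k)).Nonempty := hY
      obtain ⟨i, hi, hmax⟩ := Set.exists_max_image _ (fun i => (p.board i).length)
        (Set.toFinite _) hne
      exact ⟨_, .placeOnLongest i ht hg hX hpr' hi hmax⟩
    · push Not at hY
      exact ⟨_, .placeOnEmpty ⟨0, hk⟩ ht hg hX hpr' hY (eq_nil_of_not_topIs (hX _) (hY _))⟩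
  · by_cases hmem : X.other ∈ p.board i
    · exact ⟨_, .takeDiscardingPrisoner i hcap hmem⟩
    · exact ⟨_, .takeDiscardingGuard i hcap hmem⟩
  · exact ⟨_, .refuseDonation ht hout⟩

/-! ### Termination -/

/-- A measure that drops lexicographically with every action other than the final refusal: the
number of chips in the game, and the weight of the chips in hand, where a guard weighs 2 and a
prisoner weighs 3, so that donations lower the weight. -/
def rank (p : Position k) : ℕ ×ₗ ℕ :=
  toLex (∑ i, (p.board i).length + (p.hand blue blue + p.hand blue red + p.hand red blue
      + p.hand red red),
    2 * (p.hand blue blue + p.hand red red) + 3 * (p.hand blue red + p.hand red blue))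

theorem rank_play_lt {p : Position k} {Z : Color} {m : Move k} (hm : Legal p Z m)
    (hover : ∀ W, (play p Z m).phase ≠ .over W) : rank (play p Z m) < rank p := by
  rw [rank, rank, Prod.Lex.toLex_lt_toLex]
  cases m with
  | place c i =>
    have h := sum_update_add List.length p.board i (c :: p.board i)
    have hpos := hm.2
    rw [List.length_cons] at h
    right
    cases Z <;> cases c <;> simp [play, removeChip] <;> omega
  | take c =>
    obtain ⟨i, hcap, hmem⟩ := hm
    have h := sum_update_add List.length p.board i []
    have hpos := List.count_pos_iff.2 hmem
    have hlen : (p.board i).length = (p.board i).count blue + (p.board i).count red := by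
      generalize p.board i = π
      induction π with
      | nil => rfl
      | cons d l ih => cases d <;> simp [ih] <;> omega
    rw [List.length_nil] at h
    left
    rw [play_take hcap]
    cases Z <;> cases c <;> simp [removeChip, addChips] <;> omega
  | donate =>
    have hpos := hm.2
    right
    cases Z <;> simp [play, removeChip, addChips, Color.other] at hpos ⊢ <;> omega
  | discard =>
    have hpos := hm.2
    left
    cases Z <;> simp [play, removeChip, Color.other] at hpos ⊢ <;> omega
  | refuse => exact absurd rfl (hover Z)

theorem Invariant.wins (hk : 0 < k) {X : Color} (p : Position k) (hp : Invariant X p)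
    (hist : List (Color × Move k)) : WinsFrom (strategyS k X) X hist p := by
  induction p using WellFounded.induction (InvImage.wf rank wellFounded_lt) generalizing hist with
  | _ p ih =>
    have key : ∀ (Z : Color) (m : Move k), Legal p Z m → Invariant X (play p Z m) →
        ∀ hist', WinsFrom (strategyS k X) X hist' (play p Z m) := by
      intro Z m hm hinv hist'
      by_cases hover : ∃ W, (play p Z m).phase = .over W
      · obtain ⟨W, hW⟩ := hover
        cases hinv with
        | finished h => exact .won h
        | _ => simp_all
      · push Not at hover
        exact ih _ (rank_play_lt hm hover) hinv hist'
    by_cases hover : p.phase = .over X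
    · exact .won hover
    · refine .step ?_ (hp.acts hk) (fun m hm => (hp.own hm).1)
        (fun m hm => key _ _ (hp.own hm).1 (hp.own hm).2 _)
        (fun m hm => key _ _ hm (hp.opponent hm) _)
      intro W hW
      cases hp <;> simp_all

/-! ### At most one player has a winning strategy -/

theorem mustAct_or {p : Position k} (h : ∀ W, p.phase ≠ .over W) (X : Color) :
    MustAct p X ∨ MustAct p X.other := by
  rcases hp : p.phase with Z | ⟨Z, i⟩ | W
  · by_cases hZ : Z = X
    · subst hZ
      by_cases ho : OutOfChips p Z
      · exact .inr (.inr (.inr (by simp [hp, ho])))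
      · exact .inl (.inl ⟨hp, ho⟩)
    · obtain rfl := Color.eq_other_of_ne hZ
      by_cases ho : OutOfChips p X.other
      · exact .inl (.inr (.inr ⟨hp, ho⟩))
      · exact .inr (.inl ⟨hp, ho⟩)
  · by_cases hZ : Z = X
    · exact .inl (.inr (.inl ⟨i, by rw [hp, hZ]⟩))
    · exact .inr (.inr (.inl ⟨i, by rw [hp, Color.eq_other_of_ne hZ]⟩))
  · exact absurd hp (h W)

/-- Playing two winning strategies against each other is impossible: as long as the play is not
over, one of the players must act, and the other one still wins after that action. -/
theorem not_wins_both {σ τ : Strategy k} {X : Color} {hist : List (Color × Move k)}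
    {p : Position k} (hσ : WinsFrom σ X hist p) : ¬ WinsFrom τ X.other hist p := by
  induction hσ with
  | won h =>
    intro hτ
    cases hτ with
    | won h' => simp [h] at h'
    | step notOver => exact notOver _ h
  | step notOver acts legal own opponent ihown ihopp =>
    intro hτ
    cases hτ with
    | won h' => exact notOver _ h'
    | step _ acts' legal' own' opponent' =>
      rcases mustAct_or notOver X with h | h
      · obtain ⟨m, hm⟩ := acts h
        have := opponent' m
        rw [Color.other_other] at this
        exact ihown m hm (this (legal m hm))
      · obtain ⟨m, hm⟩ := acts' h
        exact ihopp m (legal' m hm) (own' m hm)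

theorem invariant_blue {board : Fin k → Pile} (halt : ∀ i, Alternating (board i))
    {mb mr nb nr : ℕ} (h : 0 < mb ∧ (nr = 0 ∨
        (mb : ℤ) + longSum board blue > nr + longSum board red - longMax board red)) :
    Invariant blue (startPosition board mb mr nb nr) := by
  refine .active rfl halt ?_
  simp only [Ahead, startPosition, Color.other]
  omega

theorem invariant_red {board : Fin k → Pile} (halt : ∀ i, Alternating (board i))
    {mb mr nb nr : ℕ} (h : ¬ (0 < mb ∧ (nr = 0 ∨
        (mb : ℤ) + longSum board blue > nr + longSum board red - longMax board red))) :
    Invariant red (startPosition board mb mr nb nr) := by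
  refine .waiting rfl halt ?_
  simp only [Holds, startPosition, Color.other]
  omega

end SoLongSucker

open SoLongSucker SoLongSucker.Color in
theorem mainTheorem1 {k : ℕ} (hk : 0 < k) (board : Fin k → Pile)
    (halt : ∀ i, Alternating (board i)) (mb mr nb nr : ℕ) :
    (HasWinningStrategy blue (startPosition board mb mr nb nr) ↔
      0 < mb ∧ (nr = 0 ∨
        (mb : ℤ) + longSum board blue > nr + longSum board red - longMax board red)) ∧
    (HasWinningStrategy red (startPosition board mb mr nb nr) ↔
      ¬ HasWinningStrategy blue (startPosition board mb mr nb nr)) ∧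
    ∀ X : Color, HasWinningStrategy X (startPosition board mb mr nb nr) →
      IsWinningStrategy (strategyS k X) X (startPosition board mb mr nb nr) := by
  have hnot : HasWinningStrategy blue (startPosition board mb mr nb nr) →
      ¬ HasWinningStrategy red (startPosition board mb mr nb nr) := by
    rintro ⟨σ, hσ⟩ ⟨τ, hτ⟩
    exact not_wins_both hσ hτ
  by_cases hc : 0 < mb ∧ (nr = 0 ∨
      (mb : ℤ) + longSum board blue > nr + longSum board red - longMax board red)
  · have hS : IsWinningStrategy (strategyS k blue) blue (startPosition board mb mr nb nr) :=
      (invariant_blue halt hc).wins hk _ []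
    have hb : HasWinningStrategy blue (startPosition board mb mr nb nr) := ⟨_, hS⟩
    refine ⟨iff_of_true hb hc, iff_of_false (hnot hb) (not_not.2 hb), ?_⟩
    rintro (_ | _) hX
    · exact hS
    · exact absurd hX (hnot hb)
  · have hS : IsWinningStrategy (strategyS k red) red (startPosition board mb mr nb nr) :=
      (invariant_red halt hc).wins hk _ []
    have hr : HasWinningStrategy red (startPosition board mb mr nb nr) := ⟨_, hS⟩
    have hb : ¬ HasWinningStrategy blue (startPosition board mb mr nb nr) := fun hb => hnot hb hr
    refine ⟨iff_of_false hb hc, iff_of_true hr hb, ?_⟩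
    rintro (_ | _) hX
    · exact absurd hX hb
    · exact hS
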